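/- **Theorem 1.** For a permutation $\sigma=\sigma_1\cdots\sigma_n$ of $\{1,\dots,n\}$ let $\mathrm{des}(\sigma)$ be the number of $i$ with $\sigma_i>\sigma_{i+1}$, and let $\mathrm{LRmin}(\sigma)$ be the number of left-to-right minima, i.e. of indices $j$ with $\sigma_j<\sigma_i$ for all $i<j$. For a set $\Gamma$ of permutations, let $\mathcal{NM}_n(\Gamma)$ be the set of permutations $\sigma$ of $\{1,\dots,n\}$ without $\Gamma$-matches, i.e. such that no window $\sigma_i\sigma_{i+1}\cdots\sigma_{i+j}$ ($j\ge 1$) of consecutive entries is in the same relative order as an element of $\Gamma$. Define the formal power series in $t$ $$\mathrm{NM}_\Gamma(t,x,y)=1+\sum_{n\ge1}\frac{t^n}{n!}\sum_{\sigma\in\mathcal{NM}_n(\Gamma)}x^{\mathrm{LRmin}(\sigma)}y^{1+\mathrm{des}(\sigma)}$$ with coefficients in $\mathbb{Q}[x,y]$, let $$U_\Gamma(t,y)=\frac{1}{\mathrm{NM}_\Gamma(t,1,y)},$$ with coefficients in $\mathbb{Q}[y]$, and let $U_{\Gamma,n}(y)\in\mathbb{Q}[y]$ be the coefficient of $t^n/n!$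 in $U_\Gamma(t,y)$. Let $\Gamma=\{1324,123\}$. Then $$\mathrm{NM}_\Gamma(t,x,y)=\left(\frac{1}{U_\Gamma(t,y)}\right)^x,\qquad\text{where } U_\Gamma(t,y)=1+\sum_{n\ge1}U_{\Gamma,n}(y)\frac{t^n}{n!},$$ $U_{\Gamma,0}(y)=1$, $U_{\Gamma,1}(y)=-y$, and for all $n\ge2$ $$U_{\Gamma,n}(y)=-y\,U_{\Gamma,n-1}(y)-y\,U_{\Gamma,n-2}(y)+\sum_{k=2}^{\lfloor n/2\rfloor}(-y)^kC_{k-1}U_{\Gamma,n-2k}(y),$$ where $C_j=\frac{1}{j+1}\binom{2j}{j}$ is the $j$-th Catalan number. Here $F^x=\exp(x\log F)$ for a formal power series $F$ with constant coefficient $1$. -/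

import Mathlib

open Polynomial

namespace ConsecutivePatterns

/-- A pattern: a permutation of `Fin m` for some `m`, the word `τ₁ ⋯ τ_m` being
`τ 0, …, τ (m - 1)` with both positions and values shifted down by one. -/
abbrev Pattern : Type := Σ m : ℕ, Equiv.Perm (Fin m)

/-- `des σ`: the number of positions `i` with `σ_i > σ_{i+1}`. -/
def des {n : ℕ} (σ : Equiv.Perm (Fin n)) : ℕ :=
  Fintype.card {i : Fin n // ∃ h : (i : ℕ) + 1 < n, σ ⟨i + 1, h⟩ < σ i}

/-- The number of left-to-right minima of `σ`: entries smaller than all entries to their left. -/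
def lrMin {n : ℕ} (σ : Equiv.Perm (Fin n)) : ℕ :=
  Fintype.card {j : Fin n // ∀ i : Fin n, i < j → σ j < σ i}

/-- `σ` has a `Γ`-match starting at position `i`: some window of at least two consecutive entries
starting there reduces to a member of `Γ`, i.e. its entries are in the same relative order
as those of that member. -/
def HasMatchAt (Γ : Set Pattern) {n : ℕ} (σ : Equiv.Perm (Fin n)) (i : ℕ) : Prop :=
  ∃ (m : ℕ) (τ : Equiv.Perm (Fin m)) (h : i + m ≤ n), 2 ≤ m ∧ (⟨m, τ⟩ : Pattern) ∈ Γ ∧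
    ∀ a b : Fin m,
      σ ⟨i + a, by omega⟩ < σ ⟨i + b, by omega⟩ ↔ τ a < τ b

/-- The set of permutations of length `n` without `Γ`-matches. -/
def NM (Γ : Set Pattern) (n : ℕ) : Set (Equiv.Perm (Fin n)) :=
  {σ | ∀ i : ℕ, ¬ HasMatchAt Γ σ i}

open Classical in
/-- The polynomial `NM_{Γ,n}(x,y)`, as an element of `ℚ[y][x]`: the variable `y` is `C X`, the
variable `x` is the outer `X`. By convention the term for `n = 0` is `1`. -/
noncomputable def nmPoly (Γ : Set Pattern) (n : ℕ) : ℚ[X][X] :=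
  if n = 0 then 1
  else ∑ σ : Equiv.Perm (Fin n) with σ ∈ NM Γ n, X ^ lrMin σ * (C X) ^ (1 + des σ)

/-- The exponential generating function `∑ a_n t^n / n!`. -/
noncomputable def egf {A : Type*} [CommRing A] [Algebra ℚ A] (a : ℕ → A) : PowerSeries A :=
  PowerSeries.mk fun n => (1 / (n.factorial : ℚ)) • a n

/-- `NM_Γ(t,x,y)`, a formal power series in `t` over `ℚ[y][x]`. -/
noncomputable def nmSeries (Γ : Set Pattern) : PowerSeries ℚ[X][X] :=
  egf (nmPoly Γ)

/-- `NM_Γ(t,1,y)`, a formal power series in `t` over `ℚ[y]`. -/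
noncomputable def nmSeriesOne (Γ : Set Pattern) : PowerSeries ℚ[X] :=
  PowerSeries.map (evalRingHom 1) (nmSeries Γ)

/-- The multiplicative inverse `1 / F` of a power series with constant coefficient `1`. -/
noncomputable def recip {A : Type*} [CommRing A] (F : PowerSeries A) : PowerSeries A :=
  PowerSeries.invOfUnit F 1

/-- The formal power `F ^ a = exp (a * log F)` of a power series with constant coefficient `1`. -/
noncomputable def formalPow {A : Type*} [CommRing A] [Algebra ℚ A] (F : PowerSeries A) (a : A) :
    PowerSeries A :=
  (PowerSeries.exp A).subst (PowerSeries.C a * PowerSeries.logOf F)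

/-- `U_Γ(t,y) = 1 / NM_Γ(t,1,y)`, a formal power series in `t` over `ℚ[y]`. -/
noncomputable def uSeries (Γ : Set Pattern) : PowerSeries ℚ[X] :=
  recip (nmSeriesOne Γ)

/-- `U_{Γ,n}(y)`: the coefficient of `t^n / n!` in `U_Γ(t,y)`. -/
noncomputable def uPoly (Γ : Set Pattern) (n : ℕ) : ℚ[X] :=
  (n.factorial : ℚ) • PowerSeries.coeff n (uSeries Γ)

/-- `Γ = {1324, 123}`. -/
def gamma1324And123 : Set Pattern :=
  {⟨4, Equiv.swap 1 2⟩, ⟨3, 1⟩}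

/-- The reciprocal is a genuine inverse. -/
theorem mul_recip {A : Type*} [CommRing A] {F : PowerSeries A}
    (hF : PowerSeries.constantCoeff F = 1) : F * recip F = 1 :=
  PowerSeries.mul_invOfUnit F 1 (by simpa using hF)

theorem constantCoeff_nmSeriesOne (Γ : Set Pattern) :
    PowerSeries.constantCoeff (nmSeriesOne Γ) = 1 := by
  rw [← PowerSeries.coeff_zero_eq_constantCoeff_apply]
  simp [nmSeriesOne, nmSeries, egf, nmPoly]

/-- The series `U_Γ(t,y)` has constant coefficient `1`, so its own reciprocal and the formal
powers of that reciprocal are meaningful. -/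
theorem constantCoeff_uSeries (Γ : Set Pattern) :
    PowerSeries.constantCoeff (uSeries Γ) = 1 := by
  simp [uSeries, recip]

end ConsecutivePatterns

/-! Permutations are treated as words, and a function on words is summed over all permutations.
Deleting the minimal letter turns the sum for length `n + 1` into the sum of `minDeriv f` for length
`n`; on exponential generating functions this is differentiation (`derivative_permSeries`). Since
`minDeriv` obeys the Leibniz rule for `listConv`, cutting words in two corresponds to multiplying
series (`permSeries_listConv`).

The power of `x`: both patterns begin with their least letter, so in `l₁ 0 l₂` no match meets both
`l₁` and the new minimum `0`. Hence the weight of `l₁ 0 l₂` factors, with one factor `x` for the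
left-to-right minimum `0`. The series `f` therefore solves `f' = x h f` with `h` independent of `x`,
which gives `f = F ^ x`, where `F` is the series at `x = 1`.

The reciprocal: a word of distinct letters avoids both patterns exactly when its increasing runs
have length at most two and no two successive runs `(a, b)`, `(c, d)` satisfy `a < c` and `b < d`, a
singleton `c` being read as `(c, c)`. By inclusion-exclusion the inverse of the weight under
`listConv` is a signed sum over chains of blocks increasing in both entries, each block weighted
`-y` (`listConv_wordWeight_cons`).

The recurrence: deleting minima one at a time from such a chain leaves some blocks open, their first
entry gone and their second still present. The number `h` of open blocks changes by at most one per
deletion, as in a ballot path. The ordinary generating functions satisfy `O₀ = 1 - y t (O₀ + O₁)`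
and `O_{h+1} = t (O_h - y O_{h+2})`, whence `O_{h+1} = t c O_h` with `c` the Catalan series at `-y
t²`. Comparing coefficients in `O₀ = 1 - y t O₀ - y t² c O₀` finishes the proof. -/

namespace ConsecutivePatterns

/-! ### Sums over words and permutations; insertion of a new minimum. -/

section ListSums

variable {R : Type*} [CommRing R]

/-- The sum of `f l₁ * g l₂` over all ways of writing a word as a concatenation `l₁ ++ l₂`. -/
def listConv : (List ℕ → R) → (List ℕ → R) → List ℕ → R
  | f, g, [] => f [] * g []
  | f, g, a :: l => f [] * g (a :: l) + listConv (fun l' => f (a :: l')) g l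

/-- The sum of `f` over all words obtained by inserting the letter `z` into a word. -/
def listInsert (z : ℕ) : (List ℕ → R) → List ℕ → R
  | f, [] => f [z]
  | f, a :: l => f (z :: a :: l) + listInsert z (fun l' => f (a :: l')) l

/-- The sum of `f` over all ways of inserting a new minimal letter into a word. -/
def minDeriv (f : List ℕ → R) (l : List ℕ) : R :=
  listInsert 0 f (l.map Nat.succ)

/-- `f` only depends on the relative order of the letters of a word. -/
def OrderInvariant {S : Type*} (f : List ℕ → S) : Prop :=
  ∀ φ : ℕ → ℕ, StrictMono φ → ∀ l, f (l.map φ) = f l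

/-- The sum of `f` over all permutations of length `n`, written as words. -/
def permSum (n : ℕ) (f : List ℕ → R) : R :=
  ∑ σ : Equiv.Perm (Fin n), f (List.ofFn fun i => (σ i : ℕ))

theorem listConv_add_left (f f' g : List ℕ → R) (l : List ℕ) :
    listConv (fun l => f l + f' l) g l = listConv f g l + listConv f' g l := by
  induction l generalizing f f' with
  | nil => simp [listConv, add_mul]
  | cons a l ih => simp only [listConv, ih]; ring

theorem listConv_const_mul_left (r : R) (f g : List ℕ → R) (l : List ℕ) :
    listConv (fun l => r * f l) g l = r * listConv f g l := by
  induction l generalizing f with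
  | nil => simp [listConv, mul_assoc]
  | cons a l ih => simp only [listConv, ih]; ring

theorem listConv_const_mul_right (r : R) (f g : List ℕ → R) (l : List ℕ) :
    listConv f (fun l => r * g l) l = r * listConv f g l := by
  induction l generalizing f with
  | nil => simp [listConv, mul_left_comm]
  | cons a l ih => simp only [listConv, ih]; ring

theorem listConv_map (φ : ℕ → ℕ) (f g : List ℕ → R) (l : List ℕ) :
    listConv f g (l.map φ) = listConv (fun l => f (l.map φ)) (fun l => g (l.map φ)) l := by
  induction l generalizing f with
  | nil => rfl
  | cons a l ih => simp only [listConv, List.map_cons, ih, List.map_nil]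

theorem listInsert_map (φ : ℕ → ℕ) (z : ℕ) (f : List ℕ → R) (l : List ℕ) :
    listInsert (φ z) f (l.map φ) = listInsert z (fun l => f (l.map φ)) l := by
  induction l generalizing f with
  | nil => rfl
  | cons a l ih => simp only [listInsert, List.map_cons, ih]

theorem listInsert_add (z : ℕ) (f g : List ℕ → R) (l : List ℕ) :
    listInsert z (fun l => f l + g l) l = listInsert z f l + listInsert z g l := by
  induction l generalizing f g with
  | nil => rfl
  | cons a l ih => simp only [listInsert, ih]; ring

theorem listInsert_const_mul (z : ℕ) (r : R) (f : List ℕ → R) (l : List ℕ) :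
    listInsert z (fun l => r * f l) l = r * listInsert z f l := by
  induction l generalizing f with
  | nil => rfl
  | cons a l ih => simp only [listInsert, ih]; ring

theorem listInsert_eq_zero (z : ℕ) (f : List ℕ → R) (hf : ∀ l, z ∈ l → f l = 0) (l : List ℕ) :
    listInsert z f l = 0 := by
  induction l generalizing f with
  | nil => exact hf _ (by simp)
  | cons a l ih =>
    rw [listInsert, ih _ fun l hl => hf _ (List.mem_cons_of_mem _ hl), hf _ (by simp), add_zero]

/-- Leibniz rule: in a cut of the enlarged word, the letter `z` lies in exactly one of the two
factors. -/
theorem listInsert_listConv (z : ℕ) (f g : List ℕ → R) (l : List ℕ) :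
    listInsert z (listConv f g) l =
      listConv (listInsert z f) g l + listConv f (listInsert z g) l := by
  induction l generalizing f with
  | nil => simp only [listInsert, listConv]; ring
  | cons a l ih =>
    have h1 : (fun l' => listConv f g (a :: l')) =
        fun l' => f [] * g (a :: l') + listConv (fun l'' => f (a :: l'')) g l' := rfl
    have h2 : (fun l' => listInsert z f (a :: l')) =
        fun l' => f (z :: a :: l') + listInsert z (fun l'' => f (a :: l'')) l' := rfl
    simp only [listInsert, listConv, listInsert_add, listInsert_const_mul, ih, listConv_add_left]
    ring

theorem listInsert_eq_listConv (z : ℕ) (f g h : List ℕ → R) (l : List ℕ)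
    (H : ∀ l₁ l₂, l₁ ++ l₂ = l → f (l₁ ++ z :: l₂) = g l₁ * h l₂) :
    listInsert z f l = listConv g h l := by
  induction l generalizing f g with
  | nil => exact H [] [] rfl
  | cons a l ih =>
    rw [listInsert, listConv, ih _ (fun l' => g (a :: l')) fun l₁ l₂ h => ?_]
    · rw [← H [] (a :: l) rfl]; rfl
    · exact H (a :: l₁) l₂ (by simp [h])

theorem exists_strictMono_map_succ {φ : ℕ → ℕ} (hφ : StrictMono φ) :
    ∃ ψ : ℕ → ℕ, StrictMono ψ ∧ ψ 0 = 0 ∧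
      ∀ l : List ℕ, (l.map φ).map Nat.succ = (l.map Nat.succ).map ψ := by
  refine ⟨fun k => Nat.casesOn k 0 fun k => (φ k).succ, ?_, rfl, fun l => ?_⟩
  · rintro (_ | a) (_ | b) hab
    · omega
    · exact Nat.succ_pos _
    · omega
    · exact Nat.succ_lt_succ (hφ (Nat.lt_of_succ_lt_succ hab))
  · simp [Function.comp_def]

theorem OrderInvariant.minDeriv {f : List ℕ → R} (hf : OrderInvariant f) :
    OrderInvariant (minDeriv f) := by
  intro φ hφ l
  obtain ⟨ψ, hψ, h0, h⟩ := exists_strictMono_map_succ hφ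
  have key : listInsert (ψ 0) f ((l.map Nat.succ).map ψ) = listInsert 0 f (l.map Nat.succ) := by
    rw [listInsert_map]
    congr 1
    funext l
    exact hf ψ hψ l
  rw [ConsecutivePatterns.minDeriv, h]
  rwa [h0] at key

theorem OrderInvariant.cons_zero {S : Type*} {f : List ℕ → S} (hf : OrderInvariant f) :
    OrderInvariant fun l => f (0 :: l.map Nat.succ) := by
  intro φ hφ l
  obtain ⟨ψ, hψ, h0, h⟩ := exists_strictMono_map_succ hφ
  have key := hf ψ hψ (0 :: l.map Nat.succ)
  rwa [List.map_cons, h0, ← h] at key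

/-- Order invariance undoes the shift by `Nat.succ` on the factor that does not receive the new
letter. -/
theorem minDeriv_listConv {f g : List ℕ → R} (hf : OrderInvariant f) (hg : OrderInvariant g) :
    minDeriv (listConv f g) =
      fun l => listConv (minDeriv f) g l + listConv f (minDeriv g) l := by
  funext l
  have hs : StrictMono Nat.succ := fun a b h => Nat.succ_lt_succ h
  rw [minDeriv, listInsert_listConv, listConv_map, listConv_map]
  simp only [hf _ hs, hg _ hs]
  rfl

theorem ofFn_insertNth {n : ℕ} (p : Fin (n + 1)) (z : ℕ) (f : Fin n → ℕ) :
    List.ofFn (Fin.insertNth (α := fun _ => ℕ) p z f) = (List.ofFn f).insertIdx p z := by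
  induction n with
  | zero =>
    have : p = 0 := Fin.ext (by omega)
    subst this
    simp
  | succ n ih =>
    refine Fin.cases ?_ (fun p => ?_) p
    · simp [List.ofFn_succ]
    · rw [List.ofFn_succ, List.ofFn_succ (f := f)]
      have h : (fun i : Fin (n + 1) => Fin.insertNth (α := fun _ => ℕ) p.succ z f i.succ) =
          Fin.insertNth (α := fun _ => ℕ) p z (fun i => f i.succ) := by
        funext i
        refine Fin.succAboveCases p ?_ (fun j => ?_) i
        · simp
        · rw [← Fin.succ_succAbove_succ, Fin.insertNth_apply_succAbove,
            Fin.insertNth_apply_succAbove]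
      rw [h, ih]
      have h0 : (0 : Fin (n + 2)) = p.succ.succAbove 0 := by simp
      rw [h0, Fin.insertNth_apply_succAbove]
      simp

theorem listInsert_eq_sum (z : ℕ) (f : List ℕ → R) (l : List ℕ) :
    listInsert z f l = ∑ p : Fin (l.length + 1), f (l.insertIdx p z) := by
  induction l generalizing f with
  | nil => simp [listInsert]
  | cons a l ih =>
    rw [listInsert, ih, List.length_cons, Fin.sum_univ_succ (n := l.length + 1)]
    simp

/-- The permutation obtained by inserting a new minimal value at position `p`. -/
def insertMin {n : ℕ} (p : Fin (n + 1)) (σ : Equiv.Perm (Fin n)) : Equiv.Perm (Fin (n + 1)) :=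
  (finSuccEquiv' p).trans ((Equiv.optionCongr σ).trans (finSuccEquiv' 0).symm)

theorem insertMin_self {n : ℕ} (p : Fin (n + 1)) (σ : Equiv.Perm (Fin n)) :
    insertMin p σ p = 0 := by
  simp [insertMin]

theorem insertMin_succAbove {n : ℕ} (p : Fin (n + 1)) (σ : Equiv.Perm (Fin n)) (i : Fin n) :
    insertMin p σ (p.succAbove i) = (σ i).succ := by
  simp [insertMin]

theorem insertMin_bijective (n : ℕ) :
    Function.Bijective fun q : Fin (n + 1) × Equiv.Perm (Fin n) => insertMin q.1 q.2 := by
  rw [Fintype.bijective_iff_injective_and_card]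
  constructor
  · rintro ⟨p, σ⟩ ⟨q, τ⟩ h
    simp only at h
    have hpq : p = q := by
      apply (insertMin p σ).injective
      rw [insertMin_self, h, insertMin_self]
    subst hpq
    congr 1
    ext i
    have := congrArg (fun π : Equiv.Perm (Fin (n + 1)) => π (p.succAbove i)) h
    simp only [insertMin_succAbove] at this
    rw [Fin.succ_injective _ this]
  · simp [Fintype.card_perm, Nat.factorial_succ]

/-- Each permutation of length `n + 1` arises once, from the position of its minimum and the
standardized rest. -/
theorem permSum_succ (n : ℕ) (f : List ℕ → R) : permSum (n + 1) f = permSum n (minDeriv f) := by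
  rw [permSum, ← (insertMin_bijective n).sum_comp, Fintype.sum_prod_type_right, permSum]
  refine Finset.sum_congr rfl fun σ _ => ?_
  rw [minDeriv, listInsert_eq_sum]
  have hl : ((List.ofFn fun i => (σ i : ℕ)).map Nat.succ).length + 1 = n + 1 := by simp
  rw [← (finCongr hl).sum_comp]
  refine Finset.sum_congr rfl fun p _ => ?_
  congr 1
  generalize hq : finCongr hl p = q
  have hpq : (p : ℕ) = q := by rw [← hq]; rfl
  rw [hpq, List.map_ofFn, ← ofFn_insertNth]
  congr 1
  funext i
  refine Fin.succAboveCases q ?_ (fun j => ?_) i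
  · simp [insertMin_self]
  · simp [insertMin_succAbove]

theorem permSum_zero (f : List ℕ → R) : permSum 0 f = f [] := by
  simp [permSum]

theorem permSum_add (n : ℕ) (f g : List ℕ → R) :
    permSum n (fun l => f l + g l) = permSum n f + permSum n g :=
  Finset.sum_add_distrib

theorem permSum_const_mul (n : ℕ) (r : R) (f : List ℕ → R) :
    permSum n (fun l => r * f l) = r * permSum n f :=
  (Finset.mul_sum _ _ _).symm

theorem map_permSum {S : Type*} [CommRing S] (φ : R →+* S) (n : ℕ) (f : List ℕ → R) :
    φ (permSum n f) = permSum n fun l => φ (f l) :=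
  map_sum φ _ _

end ListSums

/-! ### Exponential generating functions and formal powers. -/

section GeneratingFunctions

variable {R : Type*} [CommRing R] [Algebra ℚ R]

/-- The exponential generating function of the sums of `f` over permutations. -/
noncomputable def permSeries (f : List ℕ → R) : PowerSeries R :=
  egf fun n => permSum n f

theorem derivative_permSeries (f : List ℕ → R) :
    PowerSeries.derivative R (permSeries f) = permSeries (minDeriv f) := by
  ext n
  simp only [PowerSeries.coeff_derivative, permSeries, egf, PowerSeries.coeff_mk, permSum_succ]
  rw [← Nat.cast_succ, mul_comm, ← nsmul_eq_mul, ← Nat.cast_smul_eq_nsmul ℚ, smul_smul]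
  congr 1
  rw [Nat.factorial_succ]
  have := n.factorial_ne_zero
  push_cast
  field_simp

theorem constantCoeff_permSeries (f : List ℕ → R) :
    PowerSeries.constantCoeff (permSeries f) = f [] := by
  rw [← PowerSeries.coeff_zero_eq_constantCoeff_apply]
  simp [permSeries, egf, permSum_zero]

theorem permSeries_add (f g : List ℕ → R) :
    permSeries (fun l => f l + g l) = permSeries f + permSeries g := by
  ext n
  simp [permSeries, egf, permSum_add, smul_add]

theorem permSeries_const_mul (r : R) (f : List ℕ → R) :
    permSeries (fun l => r * f l) = PowerSeries.C r * permSeries f := by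
  ext n
  simp [permSeries, egf, permSum_const_mul, PowerSeries.coeff_C_mul]

theorem map_permSeries {S : Type*} [CommRing S] [Algebra ℚ S] (φ : R →+* S)
    (f : List ℕ → R) : PowerSeries.map φ (permSeries f) = permSeries fun l => φ (f l) := by
  ext n
  simp only [permSeries, egf, PowerSeries.coeff_map, PowerSeries.coeff_mk, ← map_permSum]
  exact map_rat_smul φ _ _

/-- Both sides have the same constant term and, by the two Leibniz rules, derivatives of the same
shape. The induction on the coefficient runs over all `f` and `g`, because it is applied to
`minDeriv f` and `minDeriv g`. -/
theorem permSeries_listConv {f g : List ℕ → R} (hf : OrderInvariant f) (hg : OrderInvariant g) :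
    permSeries (listConv f g) = permSeries f * permSeries g := by
  ext n
  induction n generalizing f g with
  | zero =>
    simp only [PowerSeries.coeff_zero_eq_constantCoeff_apply, map_mul, constantCoeff_permSeries]
    rfl
  | succ n ih =>
    have key : PowerSeries.coeff n (PowerSeries.derivative R (permSeries (listConv f g))) =
        PowerSeries.coeff n (PowerSeries.derivative R (permSeries f * permSeries g)) := by
      rw [derivative_permSeries, minDeriv_listConv hf hg, permSeries_add, map_add, ih hf.minDeriv hg,
        ih hf hg.minDeriv, Derivation.leibniz, derivative_permSeries, derivative_permSeries]
      simp only [smul_eq_mul, map_add, mul_comm, add_comm]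
    rw [PowerSeries.coeff_derivative, PowerSeries.coeff_derivative] at key
    have hu : IsUnit ((n : R) + 1) := by
      have : IsUnit (algebraMap ℚ R ((n : ℚ) + 1)) :=
        (IsUnit.mk0 _ (by positivity)).map _
      simpa using this
    exact hu.mul_right_cancel key

/-- Uniqueness for the linear differential equation `f' = h f`. -/
theorem eq_of_derivative_eq_mul {f g h : PowerSeries R}
    (hf : PowerSeries.derivative R f = h * f) (hg : PowerSeries.derivative R g = h * g)
    (h0 : PowerSeries.constantCoeff f = PowerSeries.constantCoeff g) : f = g := by
  ext n
  induction n using Nat.strong_induction_on with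
  | _ n ih =>
    cases n with
    | zero => simpa using h0
    | succ n =>
      have hu : IsUnit ((n : R) + 1) := by
        have : IsUnit (algebraMap ℚ R ((n : ℚ) + 1)) :=
          (IsUnit.mk0 _ (by positivity)).map _
        simpa using this
      refine hu.mul_right_cancel ?_
      rw [← PowerSeries.coeff_derivative, ← PowerSeries.coeff_derivative, hf, hg,
        PowerSeries.coeff_mul, PowerSeries.coeff_mul]
      refine Finset.sum_congr rfl fun p hp => ?_
      rw [ih p.2 (by have := Finset.HasAntidiagonal.mem_antidiagonal.mp hp; omega)]

theorem isUnit_of_constantCoeff_eq_one {A : Type*} [CommRing A] {F : PowerSeries A}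
    (hF : PowerSeries.constantCoeff F = 1) : IsUnit F :=
  IsUnit.of_mul_eq_one _ (mul_recip hF)

theorem mul_derivative_logOf {F : PowerSeries R} (hF : PowerSeries.constantCoeff F = 1) :
    F * PowerSeries.derivative R (PowerSeries.logOf F) = PowerSeries.derivative R F := by
  have hs : PowerSeries.HasSubst (F - 1) :=
    PowerSeries.HasSubst.of_constantCoeff_zero' (by simp [hF])
  -- `PowerSeries.log` is the series of `log (1 + X)`; substituting `F - 1` for `X` gives `F` times
  -- the outer derivative in the chain rule.
  have hlog : (1 + PowerSeries.X) * PowerSeries.derivative R (PowerSeries.log R) = 1 := by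
    rw [PowerSeries.deriv_log]
    ext n
    cases n with
    | zero => simp [add_mul]
    | succ n => simp [add_mul, PowerSeries.coeff_succ_X_mul, pow_succ, PowerSeries.coeff_one]
  have h := congrArg (PowerSeries.subst (F - 1)) hlog
  rw [← PowerSeries.coe_substAlgHom hs, map_mul, map_add, map_one, PowerSeries.coe_substAlgHom hs,
    PowerSeries.subst_X hs, add_sub_cancel] at h
  rw [PowerSeries.logOf_eq, PowerSeries.derivative_subst hs, ← mul_assoc, h, map_sub,
    PowerSeries.derivative_one, sub_zero, one_mul]

/-- A solution of `f' = a h f` is the formal power `F ^ a` of a solution of `F' = h F`. -/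
theorem eq_formalPow {f F h : PowerSeries R} (a : R)
    (hF : PowerSeries.derivative R F = h * F) (hF0 : PowerSeries.constantCoeff F = 1)
    (hf : PowerSeries.derivative R f = PowerSeries.C a * h * f)
    (hf0 : PowerSeries.constantCoeff f = 1) : f = formalPow F a := by
  have hL : PowerSeries.derivative R (PowerSeries.logOf F) = h := by
    refine (isUnit_of_constantCoeff_eq_one hF0).mul_left_cancel ?_
    rw [mul_derivative_logOf hF0, hF, mul_comm]
  have hc : PowerSeries.constantCoeff (PowerSeries.C a * PowerSeries.logOf F) = 0 := by
    rw [map_mul, PowerSeries.constantCoeff_logOf hF0, mul_zero]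
  have hs : PowerSeries.HasSubst (PowerSeries.C a * PowerSeries.logOf F) :=
    PowerSeries.HasSubst.of_constantCoeff_zero' hc
  refine eq_of_derivative_eq_mul hf ?_ ?_
  · rw [formalPow, PowerSeries.derivative_subst hs, PowerSeries.derivative_exp, Derivation.leibniz,
      PowerSeries.derivative_C, hL]
    simp [mul_comm]
  · rw [hf0, formalPow]
    erw [PowerSeries.constantCoeff_subst hs]
    rw [finsum_eq_single _ 0]
    · simp
    · intro n hn
      rw [map_pow]
      erw [hc]
      rw [zero_pow hn, smul_zero]

end GeneratingFunctions

/-! ### Pattern avoidance and the differential equation in `x`. -/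

section WordStatistics

/-- The word starts with an occurrence of the consecutive pattern `123`. -/
def StartsWith123 : List ℕ → Prop
  | a :: b :: c :: _ => a < b ∧ b < c
  | _ => False

/-- The word starts with an occurrence of the consecutive pattern `1324`. -/
def StartsWith1324 : List ℕ → Prop
  | a :: b :: c :: d :: _ => a < b ∧ ¬ b < c ∧ c < d ∧ a < c ∧ b < d
  | _ => False

/-- The word has no consecutive occurrence of `123` or `1324`. -/
def Avoids : List ℕ → Prop
  | [] => True
  | a :: l => ¬ StartsWith123 (a :: l) ∧ ¬ StartsWith1324 (a :: l) ∧ Avoids l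

noncomputable instance : DecidablePred Avoids :=
  Classical.decPred _

/-- The number of maximal increasing runs of a word. -/
def runCount : List ℕ → ℕ
  | [] => 0
  | [_] => 1
  | a :: b :: l => (if a < b then 0 else 1) + runCount (b :: l)

/-- The number of left-to-right minima of a word that are smaller than the bound `t`. -/
noncomputable def minCount : WithTop ℕ → List ℕ → ℕ
  | _, [] => 0
  | t, a :: l => if (a : WithTop ℕ) < t then 1 + minCount a l else minCount t l

theorem startsWith123_map {φ : ℕ → ℕ} (hφ : StrictMono φ) (l : List ℕ) :
    StartsWith123 (l.map φ) ↔ StartsWith123 l := by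
  rcases l with _ | ⟨a, _ | ⟨b, _ | ⟨c, l⟩⟩⟩ <;> simp [StartsWith123, hφ.lt_iff_lt]

theorem startsWith1324_map {φ : ℕ → ℕ} (hφ : StrictMono φ) (l : List ℕ) :
    StartsWith1324 (l.map φ) ↔ StartsWith1324 l := by
  rcases l with _ | ⟨a, _ | ⟨b, _ | ⟨c, _ | ⟨d, l⟩⟩⟩⟩ <;>
    simp [StartsWith1324, hφ.lt_iff_lt]

theorem orderInvariant_avoids : OrderInvariant Avoids := by
  intro φ hφ l
  induction l with
  | nil => rfl
  | cons a l ih =>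
    have h1 := startsWith123_map hφ (a :: l)
    have h2 := startsWith1324_map hφ (a :: l)
    rw [List.map_cons] at h1 h2 ⊢
    simp only [Avoids, h1, h2, ih]

theorem orderInvariant_runCount : OrderInvariant runCount := by
  intro φ hφ l
  induction l with
  | nil => rfl
  | cons a l ih =>
    cases l with
    | nil => rfl
    | cons b l =>
      rw [List.map_cons] at ih
      simp only [List.map_cons, runCount, ih, hφ.lt_iff_lt]

theorem minCount_map {φ : ℕ → ℕ} (hφ : StrictMono φ) (t : WithTop ℕ) (l : List ℕ) :
    minCount (t.map φ) (l.map φ) = minCount t l := by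
  induction l generalizing t with
  | nil => rfl
  | cons a l ih =>
    have h : ((φ a : ℕ) : WithTop ℕ) < t.map φ ↔ (a : WithTop ℕ) < t := by
      cases t with
      | top => simp
      | coe t =>
        change ((φ a : ℕ) : WithTop ℕ) < ((φ t : ℕ) : WithTop ℕ) ↔
          (a : WithTop ℕ) < ((t : ℕ) : WithTop ℕ)
        rw [Nat.cast_lt, Nat.cast_lt, hφ.lt_iff_lt]
    have h2 : minCount (φ a : ℕ) (l.map φ) = minCount a l := ih a
    simp only [List.map_cons, minCount, h, ih, h2]

theorem startsWith123_append_zero (a : ℕ) (l₁ l₂ : List ℕ) :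
    StartsWith123 (a :: l₁ ++ 0 :: l₂) ↔ StartsWith123 (a :: l₁) := by
  rcases l₁ with _ | ⟨b, _ | ⟨c, l₁⟩⟩ <;> rcases l₂ with _ | ⟨d, l₂⟩ <;> simp [StartsWith123]

theorem startsWith1324_append_zero (a : ℕ) (l₁ l₂ : List ℕ) :
    StartsWith1324 (a :: l₁ ++ 0 :: l₂) ↔ StartsWith1324 (a :: l₁) := by
  rcases l₁ with _ | ⟨b, _ | ⟨c, _ | ⟨d, l₁⟩⟩⟩ <;> rcases l₂ with _ | ⟨e, _ | ⟨f, l₂⟩⟩ <;>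
    simp [StartsWith1324]

/-- In `123` and `1324` the least letter comes first, so an occurrence containing this `0` starts at
it or later. -/
theorem avoids_append_zero (l₁ l₂ : List ℕ) :
    Avoids (l₁ ++ 0 :: l₂) ↔ Avoids l₁ ∧ Avoids (0 :: l₂) := by
  induction l₁ with
  | nil => simp [Avoids]
  | cons a l₁ ih =>
    have h1 := startsWith123_append_zero a l₁ l₂
    have h2 := startsWith1324_append_zero a l₁ l₂
    rw [List.cons_append] at h1 h2 ⊢
    rw [Avoids, Avoids, h1, h2, ih]
    tauto

theorem runCount_append_zero (l₁ l₂ : List ℕ) :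
    runCount (l₁ ++ 0 :: l₂) = runCount l₁ + runCount (0 :: l₂) := by
  induction l₁ with
  | nil => simp [runCount]
  | cons a l₁ ih =>
    cases l₁ with
    | nil => simp [runCount]
    | cons b l₁ =>
      rw [List.cons_append] at ih
      simp only [List.cons_append, runCount, ih, add_assoc]

theorem minCount_zero (l : List ℕ) : minCount (0 : ℕ) l = 0 := by
  induction l with
  | nil => rfl
  | cons a l ih => simpa [minCount] using ih

/-- The letter `0` is a new left-to-right minimum and no later letter can be one, so the statistic
ignores `l₂`. -/
theorem minCount_append_zero (t : WithTop ℕ) (ht : (0 : ℕ) < t) (l₁ l₂ : List ℕ)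
    (h : ∀ a ∈ l₁, 0 < a) : minCount t (l₁ ++ 0 :: l₂) = minCount t l₁ + 1 := by
  induction l₁ generalizing t with
  | nil =>
    have := minCount_zero l₂
    simp only [List.nil_append, minCount, if_pos ht, this]
  | cons a l₁ ih =>
    have ha : ((0 : ℕ) : WithTop ℕ) < a := by exact_mod_cast h a (by simp)
    have h' : ∀ a ∈ l₁, 0 < a := fun b hb => h b (List.mem_cons_of_mem _ hb)
    simp only [List.cons_append, minCount, ih _ ha h', ih _ ht h']
    split_ifs <;> ring

variable {R : Type*} [CommRing R]

/-- The weight `x ^ LRmin * y ^ (number of runs)` of a word avoiding the patterns. -/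
noncomputable def wordWeight (x y : R) (l : List ℕ) : R :=
  if Avoids l then x ^ minCount ⊤ l * y ^ runCount l else 0

/-- The weight, disregarding left-to-right minima, of a word with a new minimal first letter. -/
noncomputable def minFirstWeight (y : R) (l : List ℕ) : R :=
  wordWeight 1 y (0 :: l.map Nat.succ)

theorem orderInvariant_wordWeight (x y : R) : OrderInvariant (wordWeight x y) := by
  intro φ hφ l
  have h := minCount_map hφ ⊤ l
  rw [WithTop.map_top] at h
  rw [wordWeight, wordWeight, orderInvariant_runCount φ hφ, h]
  exact if_congr (iff_of_eq (orderInvariant_avoids φ hφ l)) rfl rfl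

theorem orderInvariant_minFirstWeight (y : R) : OrderInvariant (minFirstWeight y) :=
  (orderInvariant_wordWeight 1 y).cons_zero

theorem minDeriv_wordWeight (x y : R) :
    minDeriv (wordWeight x y) = fun l => x * listConv (wordWeight x y) (minFirstWeight y) l := by
  funext l
  have hs : StrictMono Nat.succ := fun a b h => Nat.succ_lt_succ h
  rw [minDeriv, listInsert_eq_listConv 0 _ (wordWeight x y)
    (fun l => x * wordWeight 1 y (0 :: l)), listConv_const_mul_right, listConv_map]
  · simp only [orderInvariant_wordWeight x y _ hs]
    rfl
  · intro l₁ l₂ h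
    have hpos : ∀ a ∈ l₁, 0 < a := by
      intro a ha
      have : a ∈ l.map Nat.succ := h ▸ List.mem_append_left _ ha
      obtain ⟨b, -, rfl⟩ := List.mem_map.mp this
      exact Nat.succ_pos b
    rw [wordWeight, wordWeight, wordWeight, if_congr (avoids_append_zero l₁ l₂) rfl rfl,
      runCount_append_zero, minCount_append_zero ⊤ (WithTop.coe_lt_top 0) _ _ hpos]
    by_cases h1 : Avoids l₁
    · by_cases h2 : Avoids (0 :: l₂)
      · rw [if_pos ⟨h1, h2⟩, if_pos h1, if_pos h2]
        ring
      · rw [if_neg fun h => h2 h.2, if_neg h2, mul_zero, mul_zero]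
    · rw [if_neg fun h => h1 h.1, if_neg h1, zero_mul]

theorem derivative_permSeries_wordWeight [Algebra ℚ R] (x y : R) :
    PowerSeries.derivative R (permSeries (wordWeight x y)) =
      PowerSeries.C x * permSeries (minFirstWeight y) * permSeries (wordWeight x y) := by
  rw [derivative_permSeries, minDeriv_wordWeight, permSeries_const_mul, permSeries_listConv
    (orderInvariant_wordWeight x y) (orderInvariant_minFirstWeight y)]
  ring

theorem wordWeight_nil (x y : R) : wordWeight x y [] = 1 := by
  simp [wordWeight, Avoids, minCount, runCount]

theorem permSeries_wordWeight_eq_formalPow [Algebra ℚ R] (x y : R) :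
    permSeries (wordWeight x y) = formalPow (permSeries (wordWeight 1 y)) x := by
  refine eq_formalPow x (h := permSeries (minFirstWeight y)) ?_ ?_ ?_ ?_
  · rw [derivative_permSeries_wordWeight, map_one, one_mul]
  · rw [constantCoeff_permSeries, wordWeight_nil]
  · exact derivative_permSeries_wordWeight x y
  · rw [constantCoeff_permSeries, wordWeight_nil]

theorem map_wordWeight {S : Type*} [CommRing S] (φ : R →+* S) (x y : R) (l : List ℕ) :
    φ (wordWeight x y l) = wordWeight (φ x) (φ y) l := by
  simp only [wordWeight]
  split_ifs <;> simp

end WordStatistics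

/-! ### Translation between permutations and words. -/

section Permutations

theorem runCount_ofFn {n : ℕ} (f : Fin (n + 1) → ℕ) :
    runCount (List.ofFn f) = 1 + ∑ i : Fin n, if f i.castSucc < f i.succ then 0 else 1 := by
  induction n with
  | zero => simp [runCount]
  | succ n ih =>
    have h := ih fun i => f i.succ
    rw [List.ofFn_succ] at h
    rw [List.ofFn_succ, List.ofFn_succ, runCount, h, Fin.sum_univ_succ (n := n)]
    simp only [Fin.castSucc_zero, Fin.succ_castSucc]
    exact Nat.add_left_comm _ _ _

theorem one_add_des {n : ℕ} (σ : Equiv.Perm (Fin (n + 1))) :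
    1 + des σ = runCount (List.ofFn fun i => (σ i : ℕ)) := by
  rw [runCount_ofFn, des, Fintype.card_subtype, Finset.card_filter, Fin.sum_univ_castSucc]
  rw [if_neg (by simp), add_zero]
  congr 1
  refine Finset.sum_congr rfl fun i _ => ?_
  have hne : σ i.castSucc ≠ σ i.succ := σ.injective.ne (Fin.castSucc_lt_succ).ne
  have h : (∃ h : (i.castSucc : ℕ) + 1 < n + 1, σ ⟨i.castSucc + 1, h⟩ < σ i.castSucc) ↔
      ¬ (σ i.castSucc : ℕ) < σ i.succ := by
    rw [not_lt, Fin.val_fin_le]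
    exact ⟨fun ⟨_, h⟩ => h.le, fun h => ⟨by simp, lt_of_le_of_ne h hne.symm⟩⟩
  simp only [h]
  split_ifs <;> rfl

open Classical in
theorem minCount_ofFn {n : ℕ} (f : Fin n → ℕ) (t : WithTop ℕ) :
    minCount t (List.ofFn f) =
      ∑ j : Fin n, if (f j : WithTop ℕ) < t ∧ ∀ i < j, f j < f i then 1 else 0 := by
  induction n generalizing t with
  | zero => simp [minCount]
  | succ n ih =>
    rw [List.ofFn_succ, minCount, Fin.sum_univ_succ, ih, ih]
    have h : ∀ j : Fin n, (∀ i < j.succ, f j.succ < f i) ↔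
        f j.succ < f 0 ∧ ∀ i < j, f j.succ < f i.succ := by
      intro j
      rw [Fin.forall_fin_succ]
      simp
    simp only [h]
    split_ifs with h1 h2 h2
    · congr 1
      refine Finset.sum_congr rfl fun j _ => if_congr ?_ rfl rfl
      rw [← and_assoc]
      refine and_congr_left fun _ => ?_
      rw [Nat.cast_lt]
      exact ⟨fun h => ⟨lt_trans (Nat.cast_lt.mpr h) h1, h⟩, fun h => h.2⟩
    · simp at h2; exact absurd h1 (not_lt.mpr h2)
    · exact absurd h2.1 h1
    · rw [zero_add]
      refine Finset.sum_congr rfl fun j _ => if_congr ?_ rfl rfl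
      refine and_congr_right fun h3 => ?_
      have : f j.succ < f 0 := Nat.cast_lt.mp (lt_of_lt_of_le h3 (not_lt.mp h1))
      simp [this]

theorem lrMin_eq_minCount {n : ℕ} (σ : Equiv.Perm (Fin n)) :
    lrMin σ = minCount ⊤ (List.ofFn fun i => (σ i : ℕ)) := by
  rw [minCount_ofFn, lrMin, Fintype.card_subtype, Finset.card_filter]
  refine Finset.sum_congr rfl fun j _ => ?_
  simp

theorem avoids_iff_forall_drop (l : List ℕ) :
    Avoids l ↔ ∀ i, ¬ StartsWith123 (l.drop i) ∧ ¬ StartsWith1324 (l.drop i) := by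
  induction l with
  | nil => simp [Avoids, StartsWith123, StartsWith1324]
  | cons a l ih =>
    rw [Avoids, ih]
    constructor
    · rintro ⟨h1, h2, h3⟩ (_ | i)
      · exact ⟨h1, h2⟩
      · exact h3 i
    · intro h
      exact ⟨(h 0).1, (h 0).2, fun i => h (i + 1)⟩

theorem startsWith123_drop (l : List ℕ) (i : ℕ) :
    StartsWith123 (l.drop i) ↔ ∃ h : i + 2 < l.length, l[i] < l[i + 1] ∧ l[i + 1] < l[i + 2] := by
  induction l generalizing i with
  | nil => simp [StartsWith123]
  | cons a l ih =>
    cases i with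
    | zero => rcases l with _ | ⟨b, _ | ⟨c, l⟩⟩ <;> simp [StartsWith123]
    | succ i =>
      rw [List.drop_succ_cons, ih]
      simp [add_right_comm i 1]

theorem startsWith1324_drop (l : List ℕ) (i : ℕ) :
    StartsWith1324 (l.drop i) ↔ ∃ h : i + 3 < l.length, l[i] < l[i + 1] ∧ ¬ l[i + 1] < l[i + 2] ∧
      l[i + 2] < l[i + 3] ∧ l[i] < l[i + 2] ∧ l[i + 1] < l[i + 3] := by
  induction l generalizing i with
  | nil => simp [StartsWith1324]
  | cons a l ih =>
    cases i with
    | zero => rcases l with _ | ⟨b, _ | ⟨c, _ | ⟨d, l⟩⟩⟩ <;> simp [StartsWith1324]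
    | succ i =>
      rw [List.drop_succ_cons, ih]
      simp [add_right_comm i 1]

theorem hasMatchAt_iff {n : ℕ} (σ : Equiv.Perm (Fin n)) (i : ℕ) :
    HasMatchAt gamma1324And123 σ i ↔
      StartsWith123 ((List.ofFn fun i => (σ i : ℕ)).drop i) ∨
        StartsWith1324 ((List.ofFn fun i => (σ i : ℕ)).drop i) := by
  rw [startsWith123_drop, startsWith1324_drop]
  simp only [List.length_ofFn, List.getElem_ofFn]
  constructor
  · rintro ⟨m, τ, hm, -, hτ, hlt⟩
    simp only [gamma1324And123, Set.mem_insert_iff, Set.mem_singleton_iff, Sigma.mk.injEq] at hτ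
    obtain ⟨rfl, hτ⟩ | ⟨rfl, hτ⟩ := hτ
    · obtain rfl := eq_of_heq hτ
      refine Or.inr ⟨by omega, ?_, ?_, ?_, ?_, ?_⟩
      · exact (hlt 0 1).mpr (by decide)
      · exact fun h => absurd ((hlt 1 2).mp h) (by decide)
      · exact (hlt 2 3).mpr (by decide)
      · exact (hlt 0 2).mpr (by decide)
      · exact (hlt 1 3).mpr (by decide)
    · obtain rfl := eq_of_heq hτ
      exact Or.inl ⟨by omega, (hlt 0 1).mpr (by decide), (hlt 1 2).mpr (by decide)⟩
  · rintro (⟨h, h1, h2⟩ | ⟨h, h1, h2, h3, h4, h5⟩)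
    · refine ⟨3, 1, by omega, by norm_num, by simp [gamma1324And123], ?_⟩
      intro a b
      rw [Fin.lt_def]
      fin_cases a <;> fin_cases b <;> simp <;> omega
    -- `StartsWith1324` only requires `¬ b < c`; injectivity of `σ` makes the middle descent strict.
    · have hne : (σ ⟨i + 1, by omega⟩ : ℕ) ≠ σ ⟨i + 2, by omega⟩ := by
        intro h
        have := σ.injective (Fin.ext h)
        simp at this
      refine ⟨4, Equiv.swap 1 2, by omega, by norm_num, by simp [gamma1324And123], ?_⟩
      have e0 : Equiv.swap (1 : Fin 4) 2 0 = 0 := by decide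
      have e3 : Equiv.swap (1 : Fin 4) 2 3 = 3 := by decide
      intro a b
      rw [Fin.lt_def]
      fin_cases a <;> fin_cases b <;> simp [e0, e3] <;> omega

theorem mem_NM_iff_avoids {n : ℕ} (σ : Equiv.Perm (Fin n)) :
    σ ∈ NM gamma1324And123 n ↔ Avoids (List.ofFn fun i => (σ i : ℕ)) := by
  rw [avoids_iff_forall_drop]
  simp only [NM, Set.mem_ofPred_eq, hasMatchAt_iff, not_or]

theorem nmPoly_eq_permSum (n : ℕ) :
    nmPoly gamma1324And123 n = permSum n (wordWeight (X : ℚ[X][X]) (C X)) := by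
  cases n with
  | zero => simp [nmPoly, permSum_zero, wordWeight_nil]
  | succ n =>
    rw [nmPoly, if_neg n.succ_ne_zero, Finset.sum_filter, permSum]
    refine Finset.sum_congr rfl fun σ _ => ?_
    rw [wordWeight, ← lrMin_eq_minCount, one_add_des]
    classical
    exact if_congr (mem_NM_iff_avoids σ) rfl rfl

theorem nmSeries_eq_permSeries :
    nmSeries gamma1324And123 = permSeries (wordWeight (X : ℚ[X][X]) (C X)) := by
  rw [nmSeries, permSeries]
  congr 1
  funext n
  exact nmPoly_eq_permSum n

theorem nmSeriesOne_eq_permSeries :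
    nmSeriesOne gamma1324And123 = permSeries (wordWeight (1 : ℚ[X]) X) := by
  rw [nmSeriesOne, nmSeries_eq_permSeries, map_permSeries]
  congr 1
  funext l
  rw [map_wordWeight]
  simp

theorem recip_recip {A : Type*} [CommRing A] {F : PowerSeries A}
    (hF : PowerSeries.constantCoeff F = 1) : recip (recip F) = F := by
  have h : PowerSeries.constantCoeff (recip F) = 1 := by simp [recip]
  refine (isUnit_of_constantCoeff_eq_one h).mul_left_cancel ?_
  rw [mul_recip h, mul_comm, mul_recip hF]

theorem constantCoeff_map_eq_one {A B : Type*} [CommRing A] [CommRing B] (φ : A →+* B)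
    {F : PowerSeries A} (hF : PowerSeries.constantCoeff F = 1) :
    PowerSeries.constantCoeff (PowerSeries.map φ F) = 1 := by
  rw [← PowerSeries.coeff_zero_eq_constantCoeff_apply, PowerSeries.coeff_map,
    PowerSeries.coeff_zero_eq_constantCoeff_apply, hF, map_one]

theorem map_recip {A B : Type*} [CommRing A] [CommRing B] (φ : A →+* B) {F : PowerSeries A}
    (hF : PowerSeries.constantCoeff F = 1) :
    PowerSeries.map φ (recip F) = recip (PowerSeries.map φ F) := by
  have h := constantCoeff_map_eq_one φ hF
  refine (isUnit_of_constantCoeff_eq_one h).mul_left_cancel ?_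
  rw [mul_recip h, ← map_mul, mul_recip hF, map_one]

theorem nmSeries_eq_formalPow :
    nmSeries gamma1324And123 =
      formalPow (recip (PowerSeries.map (C : ℚ[X] →+* ℚ[X][X]) (uSeries gamma1324And123))) X := by
  have h0 := constantCoeff_nmSeriesOne gamma1324And123
  rw [uSeries, map_recip _ h0, recip_recip (constantCoeff_map_eq_one _ h0), nmSeriesOne_eq_permSeries,
    nmSeries_eq_permSeries, permSeries_wordWeight_eq_formalPow, map_permSeries]
  congr 2
  funext l
  rw [map_wordWeight, map_one]

end Permutations

/-! ### The reciprocal series as a signed sum over increasing chains. -/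

section Chains

variable {R : Type*} [CommRing R]

/-- The sum, over all ways of cutting a word into blocks of length one or increasing blocks of
length two, of the product of the weights `w a b c d` of the pairs of consecutive blocks `(a, b)`,
`(c, d)`, the block before the first one being `(a, b)`. A block of length one is read as `(c, c)`. -/
noncomputable def chainSum (w : WithBot ℕ → WithBot ℕ → ℕ → ℕ → R) :
    WithBot ℕ → WithBot ℕ → List ℕ → R
  | _, _, [] => 1
  | a, b, [c] => w a b c c
  | a, b, c :: d :: l =>
    w a b c c * chainSum w c c (d :: l) + if c < d then w a b c d * chainSum w c d l else 0

/-- The weight `-y` if both entries of `(c, d)` exceed the corresponding ones of `(a, b)`. -/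
noncomputable def blockWeight (y : R) (a b : WithBot ℕ) (c d : ℕ) : R :=
  if a < c ∧ b < d then -y else 0

/-- The signed sum over the chains of blocks that increase in both entries. -/
noncomputable def increasingSum (y : R) : WithBot ℕ → WithBot ℕ → List ℕ → R :=
  chainSum (blockWeight y)

/-- The sum over the chains without consecutive blocks that increase in both entries. -/
noncomputable def nonincreasingSum (y : R) : WithBot ℕ → WithBot ℕ → List ℕ → R :=
  chainSum fun a b c d => y + blockWeight y a b c d

theorem blockWeight_bot (y : R) (c d : ℕ) : blockWeight y ⊥ ⊥ c d = -y :=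
  if_pos ⟨WithBot.bot_lt_coe c, WithBot.bot_lt_coe d⟩

theorem blockWeight_natCast (y : R) (a b c d : ℕ) :
    blockWeight y a b c d = if a < c ∧ b < d then -y else 0 := by
  simp [blockWeight]

theorem increasingSum_nil (y : R) (a b : WithBot ℕ) : increasingSum y a b [] = 1 := by
  simp [increasingSum, chainSum]

theorem increasingSum_singleton (y : R) (a b : WithBot ℕ) (c : ℕ) :
    increasingSum y a b [c] = blockWeight y a b c c := by
  simp [increasingSum, chainSum]

theorem increasingSum_cons_cons (y : R) (a b : WithBot ℕ) (c d : ℕ) (l : List ℕ) :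
    increasingSum y a b (c :: d :: l) = blockWeight y a b c c * increasingSum y c c (d :: l) +
      if c < d then blockWeight y a b c d * increasingSum y c d l else 0 := by
  simp [increasingSum, chainSum]

theorem nonincreasingSum_nil (y : R) (a b : WithBot ℕ) : nonincreasingSum y a b [] = 1 := by
  simp [nonincreasingSum, chainSum]

theorem nonincreasingSum_singleton (y : R) (a b : WithBot ℕ) (c : ℕ) :
    nonincreasingSum y a b [c] = y + blockWeight y a b c c := by
  simp [nonincreasingSum, chainSum]

theorem nonincreasingSum_cons_cons (y : R) (a b : WithBot ℕ) (c d : ℕ) (l : List ℕ) :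
    nonincreasingSum y a b (c :: d :: l) =
      (y + blockWeight y a b c c) * nonincreasingSum y c c (d :: l) +
      (if c < d then y + blockWeight y a b c d else 0) * nonincreasingSum y c d l := by
  simp [nonincreasingSum, chainSum]

/-- Inclusion-exclusion on the first block. A cut before it contributes `-y`, as nothing precedes it
in the right factor; a cut after it contributes `y + blockWeight`. By induction both multiply the
same increasing sum, so only `blockWeight` survives. -/
theorem listConv_nonincreasingSum (y : R) (a b : WithBot ℕ) (l : List ℕ) :
    listConv (nonincreasingSum y a b) (increasingSum y ⊥ ⊥) l = increasingSum y a b l := by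
  induction h : l.length using Nat.strong_induction_on generalizing a b l with
  | _ n ih =>
    rcases l with _ | ⟨c, _ | ⟨d, l⟩⟩
    · simp [listConv, nonincreasingSum_nil, increasingSum_nil]
    · simp only [listConv, nonincreasingSum_nil, increasingSum_nil, nonincreasingSum_singleton,
        increasingSum_singleton, blockWeight_bot]
      ring
    · have h1 := ih (l.length + 1) (by simp [← h]) c c (d :: l) (by simp)
      have h2 := ih l.length (by simp [← h]) c d l rfl
      simp only [listConv, nonincreasingSum_nil, one_mul] at h1
      simp only [listConv, nonincreasingSum_nil, nonincreasingSum_singleton,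
        nonincreasingSum_cons_cons, listConv_add_left, listConv_const_mul_left, h2,
        increasingSum_cons_cons, ← h1, blockWeight_bot]
      split_ifs <;> ring

/-- Two consecutive blocks starting with the block `(a, b)` and continuing with the given word
would form a match. -/
def Clash (a b : ℕ) : List ℕ → Prop
  | [] => False
  | [c] => b < c
  | c :: d :: _ => b < c ∨ a < c ∧ c < d ∧ b < d

theorem wordWeight_cons_cons_of_not_lt (y : R) {c d : ℕ} (h : ¬ c < d) (l : List ℕ) :
    wordWeight 1 y (c :: d :: l) = y * wordWeight 1 y (d :: l) := by
  have h1 : Avoids (c :: d :: l) ↔ Avoids (d :: l) := by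
    rcases l with _ | ⟨e, _ | ⟨f, l⟩⟩ <;> simp [Avoids, StartsWith123, StartsWith1324, h]
  rw [wordWeight, wordWeight, if_congr h1 rfl rfl, runCount, if_neg h, one_pow, one_pow, pow_add]
  split_ifs <;> ring

open Classical in
-- The run `(c, d)` splits off with weight `y` unless a match starts at `c`. Weak descents count as
-- descents in `runCount` and `StartsWith1324`, so no distinctness of letters is needed.
theorem wordWeight_cons_cons_of_lt (y : R) {c d : ℕ} (h : c < d) (l : List ℕ) :
    wordWeight 1 y (c :: d :: l) = if Clash c d l then 0 else y * wordWeight 1 y l := by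
  rcases l with _ | ⟨e, l⟩
  · simp [wordWeight, Avoids, StartsWith123, StartsWith1324, Clash, runCount, h]
  · have h1 : Avoids (c :: d :: e :: l) ↔ ¬ Clash c d (e :: l) ∧ Avoids (e :: l) := by
      rw [Avoids, Avoids]
      rcases l with _ | ⟨f, l⟩
      · simp only [StartsWith123, StartsWith1324, Clash]; tauto
      · rcases l with _ | ⟨g, l⟩ <;> simp only [StartsWith123, StartsWith1324, Clash] <;> tauto
    rw [wordWeight, wordWeight, if_congr h1 rfl rfl, runCount, if_pos h, one_pow, one_pow]
    by_cases h2 : Clash c d (e :: l)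
    · simp [h2]
    · have h3 : ¬ d < e := fun h3 => h2 (by rcases l with _ | ⟨f, l⟩ <;> simp [Clash, h3])
      rw [runCount, if_neg h3, if_neg h2]
      by_cases h4 : Avoids (e :: l)
      · rw [if_pos ⟨h2, h4⟩, if_pos h4]
        ring
      · rw [if_neg fun h => h4 h.2, if_neg h4, mul_zero]

open Classical in
-- At most one chain contributes, the one formed by the runs: at an ascent `c < d` the singleton `c`
-- clashes with what follows, and at a descent a pair is not a block.
theorem nonincreasingSum_eq (y : R) {a b : ℕ} (hab : a ≤ b) (l : List ℕ) :
    nonincreasingSum y a b l = if Clash a b l then 0 else wordWeight 1 y l := by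
  induction h : l.length using Nat.strong_induction_on generalizing a b l with
  | _ n ih =>
    rcases l with _ | ⟨c, _ | ⟨d, l⟩⟩
    · simp [nonincreasingSum_nil, Clash, wordWeight_nil]
    · rw [nonincreasingSum_singleton, blockWeight_natCast]
      have : a < c ∧ b < c ↔ b < c := by omega
      simp only [this, Clash, wordWeight, Avoids, StartsWith123, StartsWith1324, runCount]
      by_cases h : b < c <;> simp [h]
    · rw [nonincreasingSum_cons_cons, ih (l.length + 1) (by simp [← h]) le_rfl (d :: l) (by simp),
        blockWeight_natCast, blockWeight_natCast]
      by_cases hcd : c < d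
      · have h1 : Clash c c (d :: l) := by
          rcases l with _ | ⟨f, l⟩ <;> simp [Clash, hcd]
        have h2 : Clash a b (c :: d :: l) ↔ a < c ∧ b < d := by
          simp only [Clash]; omega
        rw [ih l.length (by simp [← h]) hcd.le l rfl, if_pos h1, if_pos hcd,
          wordWeight_cons_cons_of_lt y hcd]
        by_cases h3 : a < c ∧ b < d
        · rw [if_pos h3, if_pos (h2.mpr h3)]
          ring
        · rw [if_neg h3, if_neg (h2.not.mpr h3)]
          split_ifs <;> ring
      · have h1 : ¬ Clash c c (d :: l) := by
          rcases l with _ | ⟨f, l⟩ <;> simp only [Clash] <;> omega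
        have h2 : Clash a b (c :: d :: l) ↔ a < c ∧ b < c := by
          simp only [Clash]; omega
        rw [if_neg h1, if_neg hcd, wordWeight_cons_cons_of_not_lt y hcd]
        by_cases h3 : a < c ∧ b < c
        · rw [if_pos h3, if_pos (h2.mpr h3)]
          ring
        · rw [if_neg h3, if_neg (h2.not.mpr h3)]
          ring

theorem wordWeight_cons_cons (y : R) (c d : ℕ) (l : List ℕ) :
    wordWeight 1 y (c :: d :: l) =
      y * nonincreasingSum y c c (d :: l) + (if c < d then y else 0) * nonincreasingSum y c d l := by
  classical
  by_cases hcd : c < d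
  · have h1 : Clash c c (d :: l) := by
      rcases l with _ | ⟨f, l⟩ <;> simp [Clash, hcd]
    rw [wordWeight_cons_cons_of_lt y hcd, nonincreasingSum_eq y le_rfl,
      nonincreasingSum_eq y hcd.le, if_pos hcd, if_pos h1]
    split_ifs <;> ring
  · have h1 : ¬ Clash c c (d :: l) := by
      rcases l with _ | ⟨f, l⟩ <;> simp only [Clash] <;> omega
    rw [wordWeight_cons_cons_of_not_lt y hcd, nonincreasingSum_eq y le_rfl, if_neg h1, if_neg hcd]
    ring

/-- For each choice of first block, cutting before it gives `-y` and cutting later gives `y` times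
the same increasing sum. -/
theorem listConv_wordWeight_cons (y : R) (c : ℕ) (l : List ℕ) :
    listConv (wordWeight 1 y) (increasingSum y ⊥ ⊥) (c :: l) = 0 := by
  have hc : wordWeight 1 y [c] = y := by
    simp [wordWeight, Avoids, StartsWith123, StartsWith1324, runCount]
  rcases l with _ | ⟨d, l⟩
  · simp only [listConv, hc, wordWeight_nil, increasingSum_nil, increasingSum_singleton,
      blockWeight_bot]
    ring
  · have h1 := listConv_nonincreasingSum y c c (d :: l)
    simp only [listConv, nonincreasingSum_nil, one_mul] at h1
    simp only [listConv, hc, wordWeight_nil, wordWeight_cons_cons, listConv_add_left,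
      listConv_const_mul_left, listConv_nonincreasingSum, increasingSum_cons_cons,
      blockWeight_bot, ← h1]
    split_ifs <;> ring

theorem increasingSum_map (y : R) {φ : ℕ → ℕ} (hφ : StrictMono φ) (a b : WithBot ℕ)
    (l : List ℕ) : increasingSum y (a.map φ) (b.map φ) (l.map φ) = increasingSum y a b l := by
  have hlt : ∀ (a : WithBot ℕ) (c : ℕ), a.map φ < (φ c : ℕ) ↔ a < c := by
    intro a c
    cases a with
    | bot => exact iff_of_true (WithBot.bot_lt_coe _) (WithBot.bot_lt_coe _)
    | coe a =>
      change ((φ a : ℕ) : WithBot ℕ) < ((φ c : ℕ) : WithBot ℕ) ↔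
        ((a : ℕ) : WithBot ℕ) < (c : WithBot ℕ)
      rw [Nat.cast_lt, Nat.cast_lt, hφ.lt_iff_lt]
  have hw : ∀ a b c d, blockWeight y (a.map φ) (b.map φ) (φ c) (φ d) = blockWeight y a b c d := by
    intro a b c d
    simp only [blockWeight, hlt]
  induction h : l.length using Nat.strong_induction_on generalizing a b l with
  | _ n ih =>
    rcases l with _ | ⟨c, _ | ⟨d, l⟩⟩
    · rw [List.map_nil, increasingSum_nil, increasingSum_nil]
    · rw [List.map_cons, List.map_nil, increasingSum_singleton, increasingSum_singleton, hw]
    · have h1 : increasingSum y (φ c : ℕ) (φ c : ℕ) (φ d :: l.map φ) =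
          increasingSum y c c (d :: l) := ih (l.length + 1) (by simp [← h]) c c (d :: l) (by simp)
      have h2 : increasingSum y (φ c : ℕ) (φ d : ℕ) (l.map φ) =
          increasingSum y c d l := ih l.length (by simp [← h]) c d l rfl
      simp only [List.map_cons, increasingSum_cons_cons, hw, h1, h2, hφ.lt_iff_lt]

theorem orderInvariant_increasingSum (y : R) : OrderInvariant (increasingSum y ⊥ ⊥) :=
  fun _ hφ l => increasingSum_map y hφ ⊥ ⊥ l

theorem permSeries_wordWeight_mul_increasingSum [Algebra ℚ R] (y : R) :
    permSeries (wordWeight 1 y) * permSeries (increasingSum y ⊥ ⊥) = 1 := by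
  rw [← permSeries_listConv (orderInvariant_wordWeight 1 y) (orderInvariant_increasingSum y)]
  ext n
  cases n with
  | zero =>
    rw [PowerSeries.coeff_zero_eq_constantCoeff_apply, constantCoeff_permSeries]
    simp [listConv, wordWeight_nil, increasingSum_nil]
  | succ n =>
    simp [permSeries, egf, permSum, listConv_wordWeight_cons, PowerSeries.coeff_one]

theorem uSeries_eq_permSeries :
    uSeries gamma1324And123 = permSeries (increasingSum (X : ℚ[X]) ⊥ ⊥) := by
  have h0 := constantCoeff_nmSeriesOne gamma1324And123
  refine (isUnit_of_constantCoeff_eq_one h0).mul_left_cancel ?_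
  rw [uSeries, mul_recip h0, nmSeriesOne_eq_permSeries, permSeries_wordWeight_mul_increasingSum]

theorem uPoly_eq_permSum (n : ℕ) :
    uPoly gamma1324And123 n = permSum n (increasingSum (X : ℚ[X]) ⊥ ⊥) := by
  rw [uPoly, uSeries_eq_permSeries, permSeries, egf, PowerSeries.coeff_mk, smul_smul,
    mul_one_div_cancel (by exact_mod_cast n.factorial_ne_zero), one_smul]

end Chains

/-! ### Deleting minima from increasing chains; the Catalan series. -/

section OpenBlocks

variable {R : Type*} [CommRing R]

/-- The signed sum over the chains of blocks increasing in both entries that start with `h` blocks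
whose first entries have been removed from the word, `b` being the last entry before them. -/
noncomputable def openSum (y : R) : ℕ → WithBot ℕ → List ℕ → R
  | 0, b, l => increasingSum y ⊥ b l
  | _ + 1, _, [] => 0
  | h + 1, b, c :: l => if b < c then openSum y h c l else 0

theorem not_natCast_lt_zero (b : ℕ) : ¬ (b : WithBot ℕ) < (0 : ℕ) := by
  rw [Nat.cast_lt]
  omega

/-- In a chain increasing in both entries the first letter is the least, so `0` cannot occur after a
positive one. -/
theorem increasingSum_cons_eq_zero (y : R) (a b : WithBot ℕ) (c : ℕ) (hc : 0 < c) (l : List ℕ)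
    (h : 0 ∈ l) : increasingSum y a b (c :: l) = 0 := by
  induction hl : l.length using Nat.strong_induction_on generalizing a b c l with
  | _ n ih =>
    rcases l with _ | ⟨d, l⟩
    · simp at h
    · rw [increasingSum_cons_cons]
      rcases Nat.eq_zero_or_pos d with rfl | hd
      · rw [if_neg (by omega), add_zero]
        rcases l with _ | ⟨e, l⟩
        · simp [increasingSum_singleton, blockWeight]
        · simp [increasingSum_cons_cons, blockWeight]
      · have h' : 0 ∈ l := (List.mem_cons.mp h).resolve_left (by omega)
        rw [ih l.length (by simp [← hl]) _ _ _ hd l h' rfl, mul_zero, zero_add]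
        rcases l with _ | ⟨e, l⟩
        · simp at h'
        · rcases Nat.eq_zero_or_pos e with rfl | he
          · rcases l with _ | ⟨f, l⟩
            · simp [increasingSum_singleton, blockWeight]
            · simp [increasingSum_cons_cons, blockWeight]
          · have h'' : 0 ∈ l := (List.mem_cons.mp h').resolve_left (by omega)
            rw [ih l.length (by simp [← hl]) _ _ _ he l h'' rfl, mul_zero, ite_self]

theorem listInsert_increasingSum_cons (y : R) (a b : WithBot ℕ) (c : ℕ) (hc : 0 < c)
    (l : List ℕ) : listInsert 0 (fun l => increasingSum y a b (c :: l)) l = 0 :=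
  listInsert_eq_zero _ _ (fun l hl => increasingSum_cons_eq_zero y a b c hc l hl) l

/-- A deleted minimum imposes no condition on the remaining letters, so its bound can be forgotten.
-/
theorem increasingSum_zero_left (y : R) (b : WithBot ℕ) (l : List ℕ) (hl : ∀ c ∈ l, 0 < c) :
    increasingSum y (0 : ℕ) b l = increasingSum y ⊥ b l := by
  have hw : ∀ c d, 0 < c → blockWeight y (0 : ℕ) b c d = blockWeight y ⊥ b c d := by
    intro c d hc
    have h1 : ((0 : ℕ) : WithBot ℕ) < c := Nat.cast_lt.mpr hc
    have h2 : (⊥ : WithBot ℕ) < c := WithBot.bot_lt_coe c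
    rw [blockWeight, blockWeight, if_congr (and_congr_left fun _ => iff_of_true h1 h2) rfl rfl]
  rcases l with _ | ⟨c, _ | ⟨d, l⟩⟩
  · rw [increasingSum_nil, increasingSum_nil]
  · rw [increasingSum_singleton, increasingSum_singleton, hw _ _ (hl _ (by simp))]
  · rw [increasingSum_cons_cons, increasingSum_cons_cons, hw _ _ (hl _ (by simp)),
      hw _ _ (hl _ (by simp))]

theorem increasingSum_zero_right (y : R) (a : WithBot ℕ) (l : List ℕ) (hl : ∀ c ∈ l, 0 < c) :
    increasingSum y a (0 : ℕ) l = increasingSum y a ⊥ l := by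
  have hw : ∀ c d, 0 < d → blockWeight y a (0 : ℕ) c d = blockWeight y a ⊥ c d := by
    intro c d hd
    have h1 : ((0 : ℕ) : WithBot ℕ) < d := Nat.cast_lt.mpr hd
    have h2 : (⊥ : WithBot ℕ) < d := WithBot.bot_lt_coe d
    rw [blockWeight, blockWeight, if_congr (and_congr_right fun _ => iff_of_true h1 h2) rfl rfl]
  rcases l with _ | ⟨c, _ | ⟨d, l⟩⟩
  · rw [increasingSum_nil, increasingSum_nil]
  · rw [increasingSum_singleton, increasingSum_singleton, hw _ _ (hl _ (by simp))]
  · rw [increasingSum_cons_cons, increasingSum_cons_cons, hw _ _ (hl _ (by simp)),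
      hw _ _ (hl _ (by simp))]

theorem openSum_zero_left (y : R) (h : ℕ) (l : List ℕ) (hl : ∀ c ∈ l, 0 < c) :
    openSum y h (0 : ℕ) l = openSum y h ⊥ l := by
  rcases h with _ | h
  · exact increasingSum_zero_right y ⊥ l hl
  · rcases l with _ | ⟨c, l⟩
    · rfl
    · have h1 : ((0 : ℕ) : WithBot ℕ) < c := Nat.cast_lt.mpr (hl c (by simp))
      have h2 : (⊥ : WithBot ℕ) < c := WithBot.bot_lt_coe c
      rw [openSum, openSum, if_pos h1, if_pos h2]

/-- Below a bound `b` the new minimum cannot be a second entry. It must follow all `h` open letters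
and begin a pair `(0, c)`, whose deletion of `0` leaves one more open letter. -/
theorem listInsert_openSum_natCast (y : R) (h b : ℕ) (l : List ℕ) (hl : ∀ c ∈ l, 0 < c) :
    listInsert 0 (openSum y h b) l = -y * openSum y (h + 1) b l := by
  induction h generalizing b l with
  | zero =>
    rcases l with _ | ⟨c, l⟩
    · simp [listInsert, openSum, increasingSum_singleton, blockWeight]
    · have hc : 0 < c := hl c (by simp)
      have hl' : ∀ c ∈ l, 0 < c := fun d hd => hl d (List.mem_cons_of_mem _ hd)
      have h1 : blockWeight y ⊥ b 0 0 = 0 := if_neg fun h => not_natCast_lt_zero _ h.2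
      have h2 : blockWeight y ⊥ b 0 c = if (b : WithBot ℕ) < c then -y else 0 := by
        rw [blockWeight, if_congr (and_iff_right (show ⊥ < ((0 : ℕ) : WithBot ℕ) from
          WithBot.bot_lt_coe 0)) rfl rfl]
      have h3 := listInsert_increasingSum_cons y ⊥ b c hc l
      simp only [listInsert, openSum, increasingSum_cons_cons, h1, h2, h3, if_pos hc,
        increasingSum_zero_left y c l hl']
      split_ifs <;> ring
  | succ h ih =>
    rcases l with _ | ⟨c, l⟩
    · simp [listInsert, openSum]
    · have hl' : ∀ c ∈ l, 0 < c := fun d hd => hl d (List.mem_cons_of_mem _ hd)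
      simp only [listInsert, openSum]
      rw [if_neg (not_natCast_lt_zero b), zero_add]
      by_cases hbc : (b : WithBot ℕ) < c
      · simp only [if_pos hbc]
        exact ih c l hl'
      · simp only [if_neg hbc, mul_zero]
        exact listInsert_eq_zero _ _ (fun _ _ => rfl) l

theorem openSum_map (y : R) {φ : ℕ → ℕ} (hφ : StrictMono φ) (h : ℕ) (b : WithBot ℕ)
    (l : List ℕ) : openSum y h (b.map φ) (l.map φ) = openSum y h b l := by
  induction h generalizing b l with
  | zero => exact increasingSum_map y hφ ⊥ b l
  | succ h ih =>
    rcases l with _ | ⟨c, l⟩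
    · rfl
    · have hlt : b.map φ < (φ c : ℕ) ↔ b < c := by
        cases b with
        | bot => exact iff_of_true (WithBot.bot_lt_coe _) (WithBot.bot_lt_coe _)
        | coe b =>
          change ((φ b : ℕ) : WithBot ℕ) < ((φ c : ℕ) : WithBot ℕ) ↔
            ((b : ℕ) : WithBot ℕ) < (c : WithBot ℕ)
          rw [Nat.cast_lt, Nat.cast_lt, hφ.lt_iff_lt]
      have h1 : openSum y h (φ c : ℕ) (l.map φ) = openSum y h c l := ih c l
      rw [List.map_cons, openSum, openSum, if_congr hlt h1 rfl]

theorem openSum_bot_map_succ (y : R) (h : ℕ) (l : List ℕ) :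
    openSum y h ⊥ (l.map Nat.succ) = openSum y h ⊥ l :=
  openSum_map y (fun _ _ h => Nat.succ_lt_succ h) h ⊥ l

theorem pos_of_mem_map_succ {l : List ℕ} : ∀ c ∈ l.map Nat.succ, 0 < c := by
  simp

/-- With no open block, the minimum is either a singleton or the first entry of a pair, which
becomes open. -/
theorem minDeriv_openSum_zero (y : R) :
    minDeriv (openSum y 0 ⊥) = fun l => -y * openSum y 0 ⊥ l + -y * openSum y 1 ⊥ l := by
  funext l
  rw [← openSum_bot_map_succ y 0 l, ← openSum_bot_map_succ y 1 l, minDeriv]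
  have hl := pos_of_mem_map_succ (l := l)
  revert hl
  generalize l.map Nat.succ = l
  intro hl
  rcases l with _ | ⟨c, l⟩
  · simp [listInsert, openSum, increasingSum_singleton, increasingSum_nil, blockWeight_bot]
  · have hc : 0 < c := hl c (by simp)
    have hl' : ∀ c ∈ l, 0 < c := fun d hd => hl d (List.mem_cons_of_mem _ hd)
    have h3 := listInsert_increasingSum_cons y ⊥ ⊥ c hc l
    have h4 : (⊥ : WithBot ℕ) < c := WithBot.bot_lt_coe c
    simp only [listInsert, openSum]
    rw [increasingSum_cons_cons, h3, blockWeight_bot, blockWeight_bot, if_pos hc, if_pos h4,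
      increasingSum_zero_left y _ _ hl, increasingSum_zero_right y _ _ hl,
      increasingSum_zero_left y c l hl', add_zero]

/-- The minimum either is the first open letter, closing its block, or opens a new block behind the
open ones. The factor `-y` is paid on opening only. -/
theorem minDeriv_openSum_succ (y : R) (h : ℕ) :
    minDeriv (openSum y (h + 1) ⊥) =
      fun l => openSum y h ⊥ l + -y * openSum y (h + 2) ⊥ l := by
  funext l
  rw [← openSum_bot_map_succ y h l, ← openSum_bot_map_succ y (h + 2) l, minDeriv]
  have hl := pos_of_mem_map_succ (l := l)
  revert hl
  generalize l.map Nat.succ = l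
  intro hl
  have h0 : (⊥ : WithBot ℕ) < (0 : ℕ) := WithBot.bot_lt_coe 0
  rcases l with _ | ⟨c, l⟩
  · have := openSum_zero_left y h [] hl
    simp only [listInsert, openSum, if_pos h0, this]
    ring
  · have hl' : ∀ c ∈ l, 0 < c := fun d hd => hl d (List.mem_cons_of_mem _ hd)
    have h4 : (⊥ : WithBot ℕ) < c := WithBot.bot_lt_coe c
    have h5 := listInsert_openSum_natCast y h c l hl'
    simp only [listInsert, openSum, if_pos h0, if_pos h4, openSum_zero_left y h (c :: l) hl]
    rw [h5]

/-- The ordinary generating function of the sums of `openSum y h ⊥` over permutations. -/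
noncomputable def openSeries (y : R) (h : ℕ) : PowerSeries R :=
  PowerSeries.mk fun n => permSum n (openSum y h ⊥)

theorem openSeries_zero (y : R) :
    openSeries y 0 = 1 + PowerSeries.X * (PowerSeries.C (-y) * (openSeries y 0 + openSeries y 1)) := by
  ext n
  cases n with
  | zero => simp [openSeries, permSum_zero, openSum, increasingSum_nil]
  | succ n =>
    rw [map_add, PowerSeries.coeff_succ_X_mul, PowerSeries.coeff_C_mul]
    simp only [openSeries, PowerSeries.coeff_mk, map_add, permSum_succ, minDeriv_openSum_zero,
      permSum_add, permSum_const_mul, PowerSeries.coeff_one]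
    simp
    ring

theorem openSeries_succ (y : R) (h : ℕ) :
    openSeries y (h + 1) =
      PowerSeries.X * (openSeries y h + PowerSeries.C (-y) * openSeries y (h + 2)) := by
  ext n
  cases n with
  | zero => simp [openSeries, permSum_zero, openSum]
  | succ n =>
    rw [PowerSeries.coeff_succ_X_mul, map_add, PowerSeries.coeff_C_mul]
    simp only [openSeries, PowerSeries.coeff_mk, permSum_succ, minDeriv_openSum_succ,
      permSum_add, permSum_const_mul]

/-- The generating function of the Catalan numbers evaluated at `-y t ^ 2`. -/
noncomputable def signedCatalanSeries (y : R) : PowerSeries R :=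
  PowerSeries.expand 2 two_ne_zero
    (PowerSeries.rescale (-y) (PowerSeries.map (Nat.castRingHom R) PowerSeries.catalanSeries))

theorem signedCatalanSeries_eq (y : R) :
    signedCatalanSeries y =
      1 + PowerSeries.C (-y) * PowerSeries.X ^ 2 * signedCatalanSeries y ^ 2 := by
  have h := congrArg (fun F => PowerSeries.expand 2 two_ne_zero (PowerSeries.rescale (-y)
    (PowerSeries.map (Nat.castRingHom R) F))) PowerSeries.catalanSeries_sq_mul_X_add_one
  simp only [map_add, map_mul, map_pow, map_one, PowerSeries.map_X, PowerSeries.rescale_X,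
    PowerSeries.expand_C, PowerSeries.expand_X] at h
  rw [signedCatalanSeries]
  nth_rewrite 1 [← h]
  ring

theorem coeff_mul_two_signedCatalanSeries (y : R) (k : ℕ) :
    PowerSeries.coeff (2 * k) (signedCatalanSeries y) = (-y) ^ k * catalan k := by
  rw [signedCatalanSeries, PowerSeries.coeff_expand_mul]
  simp [PowerSeries.coeff_rescale]

theorem coeff_signedCatalanSeries_of_not_dvd (y : R) {n : ℕ} (h : ¬ 2 ∣ n) :
    PowerSeries.coeff n (signedCatalanSeries y) = 0 :=
  PowerSeries.coeff_expand_of_not_dvd _ _ _ h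

/-- By the quadratic equation for `c`, multiplication by `t c` at each level solves the same
recursion. The error `e h` is `t` times a combination of `e (h + 1)` and `e h`, so every power of
`t` divides all errors, and they vanish. -/
theorem openSeries_succ_eq_mul (y : R) (h : ℕ) :
    openSeries y (h + 1) = PowerSeries.X * signedCatalanSeries y * openSeries y h := by
  set c := signedCatalanSeries y with hc
  have hcc : c = 1 + PowerSeries.C (-y) * PowerSeries.X ^ 2 * c ^ 2 := signedCatalanSeries_eq y
  let e : ℕ → PowerSeries R := fun h => openSeries y (h + 1) - PowerSeries.X * c * openSeries y h
  have he : ∀ h, e h = PowerSeries.X * (PowerSeries.C (-y) * (e (h + 1) +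
      PowerSeries.X * c * e h)) := by
    intro h
    have h1 := openSeries_succ y h
    have h2 : PowerSeries.X * c * openSeries y h = PowerSeries.X *
        (1 + PowerSeries.C (-y) * PowerSeries.X ^ 2 * c ^ 2) * openSeries y h := by rw [← hcc]
    simp only [e]
    linear_combination h1 - h2
  have hdvd : ∀ n h, (PowerSeries.X : PowerSeries R) ^ n ∣ e h := by
    intro n
    induction n with
    | zero => simp
    | succ n ih =>
      intro h
      rw [he, pow_succ']
      exact mul_dvd_mul_left _ (((ih (h + 1)).add ((ih h).mul_left _)).mul_left _)
  have he0 : e h = 0 := by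
    ext n
    rw [map_zero]
    exact PowerSeries.X_pow_dvd_iff.mp (hdvd (n + 1) h) n (Nat.lt_succ_self n)
  exact sub_eq_zero.mp he0

theorem permSum_openSum_succ_succ (y : R) (n : ℕ) :
    permSum (n + 2) (openSum y 0 ⊥) = -y * permSum (n + 1) (openSum y 0 ⊥) +
      ∑ k ∈ Finset.range (n / 2 + 1),
        (-y) ^ (k + 1) * (catalan k : R) * permSum (n - 2 * k) (openSum y 0 ⊥) := by
  have h := congrArg (PowerSeries.coeff (n + 2)) (openSeries_zero y)
  have h1 : openSeries y 1 = PowerSeries.X * (signedCatalanSeries y * openSeries y 0) := by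
    rw [openSeries_succ_eq_mul y 0, mul_assoc]
  rw [map_add, PowerSeries.coeff_succ_X_mul, PowerSeries.coeff_C_mul, map_add, h1,
    PowerSeries.coeff_succ_X_mul, PowerSeries.coeff_mul, PowerSeries.coeff_one,
    if_neg (by omega), zero_add, mul_add, Finset.Nat.sum_antidiagonal_eq_sum_range_succ_mk] at h
  simp only [openSeries, PowerSeries.coeff_mk] at h
  rw [h, Finset.mul_sum]
  congr 1
  symm
  -- Only even powers of `t` occur in the Catalan series at `-y t²`.
  refine Finset.sum_of_injOn (fun k => 2 * k) (fun a _ b _ h => by simpa using h) ?_ ?_ ?_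
  · intro k hk
    simp only [Finset.coe_range, Set.mem_Iio] at hk ⊢
    omega
  · intro m hm hm'
    rw [coeff_signedCatalanSeries_of_not_dvd, zero_mul, mul_zero]
    rintro ⟨k, rfl⟩
    refine hm' ⟨k, ?_, rfl⟩
    simp only [Finset.mem_range, Finset.coe_range, Set.mem_Iio] at hm ⊢
    omega
  · intro k _
    rw [coeff_mul_two_signedCatalanSeries]
    ring

end OpenBlocks

/-! ### Initial values and recurrence. -/

theorem uPoly_zero : uPoly gamma1324And123 0 = 1 := by
  rw [uPoly_eq_permSum, permSum_zero, increasingSum_nil]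

theorem uPoly_one : uPoly gamma1324And123 1 = -X := by
  rw [uPoly_eq_permSum, permSum_succ, permSum_zero]
  exact blockWeight_bot X 0 0

theorem uPoly_recurrence (n : ℕ) (hn : 2 ≤ n) :
    uPoly gamma1324And123 n =
      -(X : ℚ[X]) * uPoly gamma1324And123 (n - 1) - (X : ℚ[X]) * uPoly gamma1324And123 (n - 2) +
        ∑ k ∈ Finset.Icc 2 (n / 2),
          (-(X : ℚ[X])) ^ k * (catalan (k - 1) : ℚ[X]) * uPoly gamma1324And123 (n - 2 * k) := by
  obtain ⟨n, rfl⟩ := Nat.exists_eq_add_of_le' hn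
  simp only [uPoly_eq_permSum]
  have h := permSum_openSum_succ_succ (X : ℚ[X]) n
  change permSum _ (increasingSum X ⊥ ⊥) = -X * permSum _ (increasingSum X ⊥ ⊥) +
    ∑ k ∈ _, _ * permSum _ (increasingSum X ⊥ ⊥) at h
  -- The bottom term, with `catalan 0 = 1`, is split off as `-y U_{n-2}`; the rest is reindexed to
  -- start at `2`.
  rw [h, Finset.sum_range_succ', Finset.sum_bij' (t := Finset.Icc 2 ((n + 2) / 2))
    (g := fun k => (-(X : ℚ[X])) ^ k * (catalan (k - 1) : ℚ[X]) *
      permSum (n + 2 - 2 * k) (increasingSum X ⊥ ⊥)) (fun k _ => k + 2) (fun k _ => k - 2)]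
  · simp
    ring
  · intro k hk
    simp only [Finset.mem_range, Finset.mem_Icc] at hk ⊢
    omega
  · intro k hk
    simp only [Finset.mem_range, Finset.mem_Icc] at hk ⊢
    omega
  · intro k _
    simp
  · intro k hk
    simp only [Finset.mem_Icc] at hk
    omega
  · intro k _
    have : n + 2 - 2 * (k + 2) = n - 2 * (k + 1) := by omega
    simp [this]

end ConsecutivePatterns

theorem theorem1 :
    ConsecutivePatterns.nmSeries ConsecutivePatterns.gamma1324And123 =
        ConsecutivePatterns.formalPow
          (ConsecutivePatterns.recip
            (PowerSeries.map (Polynomial.C : ℚ[X] →+* ℚ[X][X])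
              (ConsecutivePatterns.uSeries ConsecutivePatterns.gamma1324And123)))
          (Polynomial.X : ℚ[X][X]) ∧
      ConsecutivePatterns.uSeries ConsecutivePatterns.gamma1324And123 =
        ConsecutivePatterns.egf
          (ConsecutivePatterns.uPoly ConsecutivePatterns.gamma1324And123) ∧
      ConsecutivePatterns.uPoly ConsecutivePatterns.gamma1324And123 0 = 1 ∧
      ConsecutivePatterns.uPoly ConsecutivePatterns.gamma1324And123 1 = -(X : ℚ[X]) ∧
      ∀ n : ℕ, 2 ≤ n →
        ConsecutivePatterns.uPoly ConsecutivePatterns.gamma1324And123 n =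
          -(X : ℚ[X]) * ConsecutivePatterns.uPoly ConsecutivePatterns.gamma1324And123 (n - 1)
          - (X : ℚ[X]) * ConsecutivePatterns.uPoly ConsecutivePatterns.gamma1324And123 (n - 2)
          + ∑ k ∈ Finset.Icc 2 (n / 2),
              (-(X : ℚ[X])) ^ k * (catalan (k - 1) : ℚ[X]) *
                ConsecutivePatterns.uPoly ConsecutivePatterns.gamma1324And123 (n - 2 * k) := by
  refine ⟨ConsecutivePatterns.nmSeries_eq_formalPow, ?_, ConsecutivePatterns.uPoly_zero,
    ConsecutivePatterns.uPoly_one, ConsecutivePatterns.uPoly_recurrence⟩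
  rw [ConsecutivePatterns.uSeries_eq_permSeries, ConsecutivePatterns.permSeries]
  congr 1
  funext n
  rw [ConsecutivePatterns.uPoly_eq_permSum]
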